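/- Let $k\ge 2$ and let $P,Q\in\mathbb R[x]$ be two polynomials of degree exactly $k$, each of which has only real roots, all nonzero and of the same sign (all positive or all negative; the sign for $P$ may differ from the sign for $Q$). Write $P(x)=\sum_{j=0}^k\binom kj a_jx^j$ and $Q(x)=\sum_{j=0}^k\binom kj b_jx^j$, and let $$(P*Q)(x)=\sum_{j=0}^k\binom kj a_jb_jx^j$$ be their Schur–Szegő product. For a polynomial $R$ of degree $k$ with all roots real, nonzero and of the same sign, order the roots, repeated according to multiplicity, as $|x_1|\le|x_2|\le\dots\le|x_k|$ and define its logarithmic mesh by $$\operatorname{lmesh}(R)=\min_{1\le j\le k-1}\frac{|x_{j+1}|}{|x_j|}.$$ Then $P*Q$ also has degree $k$ and only real, nonzero roots of the same sign (so that $\operatorname{lmesh}(P*Q)$ is defined), and $$\operatorname{lmesh}(P*Q)\ge\max\bigl(\operatorname{lmesh}(P),\operatorname{lmesh}(Q)\bigr).$$ -/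

import Mathlib

open Polynomial

/-- All complex roots of the (nonzero) real polynomial `P` are real, and they all have the same
sign: either all are positive or all are negative. -/
structure HasRealRootsOfSameSign (P : ℝ[X]) : Prop where
  ne_zero : P ≠ 0
  real_rooted : P.Splits
  same_sign : (∀ x ∈ P.roots, 0 < x) ∨ (∀ x ∈ P.roots, x < 0)

/-- The coefficient `a_j` of `P` in the expansion `P = ∑_{j ≤ k} (k choose j) a_j x^j`. -/
noncomputable def binomCoeff (k : ℕ) (P : ℝ[X]) (j : ℕ) : ℝ :=
  P.coeff j / (k.choose j : ℝ)

/-- The coefficients `binomCoeff k P j` are indeed the coefficients of `P` in the binomial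
basis. -/
theorem sum_binomCoeff (k : ℕ) (P : ℝ[X]) (hP : P.natDegree ≤ k) :
    ∑ j ∈ Finset.range (k + 1), C ((k.choose j : ℝ) * binomCoeff k P j) * X ^ j = P := by
  conv_rhs => rw [P.as_sum_range_C_mul_X_pow' (Nat.lt_succ_of_le hP)]
  refine Finset.sum_congr rfl fun j hj => ?_
  have h : (k.choose j : ℝ) ≠ 0 :=
    Nat.cast_ne_zero.2 (Nat.choose_pos (Nat.lt_succ_iff.1 (Finset.mem_range.1 hj))).ne'
  rw [binomCoeff, mul_div_cancel₀ _ h]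

/-- The Schur–Szegő product, with respect to the degree `k`, of
`P = ∑_{j ≤ k} (k choose j) a_j x^j` and `Q = ∑_{j ≤ k} (k choose j) b_j x^j`:
the polynomial `∑_{j ≤ k} (k choose j) a_j b_j x^j`. -/
noncomputable def schurSzego (k : ℕ) (P Q : ℝ[X]) : ℝ[X] :=
  ∑ j ∈ Finset.range (k + 1),
    C ((k.choose j : ℝ) * binomCoeff k P j * binomCoeff k Q j) * X ^ j

/-- The absolute values of the real roots of `P`, counted with multiplicity, in nondecreasing
order. -/
noncomputable def rootModuli (P : ℝ[X]) : List ℝ :=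
  (P.roots.map fun x => |x|).sort (· ≤ ·)

/-- The logarithmic mesh: the least ratio of two consecutive root moduli. The infimum is over a
finite index set, which is nonempty (so that the infimum is a minimum) as soon as there are at
least two roots. -/
noncomputable def lmesh (P : ℝ[X]) : ℝ :=
  ⨅ j : Fin ((rootModuli P).length - 1),
    ((rootModuli P)[j.1 + 1]'(by omega)) / ((rootModuli P)[j.1]'(by omega))

/-! Everything follows from one transfer principle. Multiply the coefficients of `P` by a complex
sequence `m`. If the resulting polynomial has no zero in a closed half-plane containing `-x / r` for
every root `r` of `Q`, then the same transform of `P * Q` is nonzero at `x`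
(`multiplierEval_schurSzego_ne_zero`). This is Grace–Walsh–Szegő, obtained by iterating Laguerre's
theorem over the roots of `Q`.

With `m = 1` and suitable half-planes it shows that the roots of `P * Q` are real and of one sign.
For the mesh, let `x` be real, so that all `-x / r` are real and the closed upper half-plane serves.
If `1 < q < lmesh P`, a Hermite–Biehler argument shows that `P(z) + iτ P(qz)` has no zero there, `τ`
being the sign of the roots of `P`. Hence `x` and `q x` are never both roots of `P * Q`. The
limiting case `q = 1` uses `P(z) + iτ z P'(z)`: simple roots of `P` force simple roots of `P * Q`.
Consecutive moduli of `P * Q` with ratio below `lmesh P` are thereby excluded, and symmetry of the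
product gives the maximum. -/

/-! ### Laguerre's theorem and Grace–Walsh–Szegő for a half-plane -/

/-- The region `t|u|² < Im(ω ū)` is convex. Replacing `|u|²` by its tangent minorant `2 Re(u Ū) -
|U|²` makes the condition affine, so it can be summed over `s`. -/
theorem affine_bound_of_forall_mem (ω U : ℂ) (t : ℝ) (ht : 0 ≤ t) (s : Multiset ℂ)
    (hs : ∀ u ∈ s, t * Complex.normSq u < (ω * starRingEnd ℂ u).im) :
    s = 0 ∨ t * (2 * (s.sum * starRingEnd ℂ U).re - s.card * Complex.normSq U)
      < (ω * starRingEnd ℂ s.sum).im := by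
  induction s using Multiset.induction with
  | empty => exact Or.inl rfl
  | cons u s ih =>
    right
    have hu := hs u (Multiset.mem_cons_self u s)
    have h1 : t * (2 * (u * starRingEnd ℂ U).re - Complex.normSq U) ≤ t * Complex.normSq u := by
      refine mul_le_mul_of_nonneg_left ?_ ht
      have := Complex.normSq_nonneg (u - U)
      rw [Complex.normSq_sub] at this
      linarith
    have h2 : t * (2 * (s.sum * starRingEnd ℂ U).re - s.card * Complex.normSq U)
        ≤ (ω * starRingEnd ℂ s.sum).im := by
      rcases ih fun v hv => hs v (Multiset.mem_cons_of_mem hv) with rfl | h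
      · simp
      · exact h.le
    simp only [Multiset.sum_cons, Multiset.card_cons, map_add, mul_add, add_mul, Complex.add_re,
      Complex.add_im, Nat.cast_add, Nat.cast_one] at *
    linarith

/-- Laguerre's theorem on polar derivatives, for a closed half-plane. -/
theorem polar_derivative_ne_zero (n : ℕ) (F : ℂ[X]) (hF : F.natDegree ≤ n + 1) (ω : ℂ) (c : ℝ)
    (h : ∀ z : ℂ, c ≤ (ω * z).im → F.eval z ≠ 0) (ζ : ℂ) (hζ : c ≤ (ω * ζ).im)
    (z : ℂ) (hz : c ≤ (ω * z).im) :
    F.eval z + (ζ - z) * (F.derivative.eval z / (n + 1)) ≠ 0 := by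
  intro h0
  have hFz := h z hz
  have hn : (n + 1 : ℂ) ≠ 0 := by exact_mod_cast n.succ_ne_zero
  have hzζ : z - ζ ≠ 0 := by
    intro e
    rw [← neg_sub, e] at h0
    simp at h0
    exact hFz h0
  set s := F.roots.map fun r => 1 / (z - r) with hs
  have hsum : F.derivative.eval z / F.eval z = s.sum :=
    (IsAlgClosed.splits F).eval_derivative_div_eval_of_ne_zero hFz
  set U := 1 / (z - ζ) with hU
  have hU0 : U ≠ 0 := one_div_ne_zero hzζ
  have hsU : s.sum = (n + 1) * U := by
    rw [← hsum, hU]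
    field_simp
    field_simp at h0
    linear_combination -h0
  have key : ∀ r : ℂ, z - r ≠ 0 →
      (ω * starRingEnd ℂ (1 / (z - r))).im
        = ((ω * z).im - (ω * r).im) * Complex.normSq (1 / (z - r)) := by
    intro r hr
    have : ω * starRingEnd ℂ (1 / (z - r))
        = (Complex.normSq (1 / (z - r)) : ℂ) * (ω * z - ω * r) := by
      rw [← Complex.mul_conj]
      field_simp
    rw [this, Complex.im_ofReal_mul, Complex.sub_im, mul_comm]
  -- Inversion about `z` sends the roots of `F` into a convex region that excludes `U`, whereas a
  -- vanishing polar derivative makes `U` equal to `s.sum / (n + 1)`.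
  have hmem : ∀ u ∈ s, ((ω * z).im - c) * Complex.normSq u < (ω * starRingEnd ℂ u).im := by
    intro u hu
    obtain ⟨r, hr, rfl⟩ := Multiset.mem_map.1 hu
    have hroot : F.eval r = 0 := (mem_roots'.1 hr).2
    have hrz : z - r ≠ 0 := by
      intro e
      rw [sub_eq_zero.1 e] at hFz
      exact hFz hroot
    rw [key r hrz]
    refine mul_lt_mul_of_pos_right ?_ (Complex.normSq_pos.2 (one_div_ne_zero hrz))
    have : (ω * r).im < c := lt_of_not_ge fun hc => h r hc hroot
    linarith
  rcases affine_bound_of_forall_mem ω U ((ω * z).im - c) (by linarith) s hmem with h1 | h1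
  · rw [h1, Multiset.sum_zero] at hsU
    exact mul_ne_zero hn hU0 hsU.symm
  -- `F` may have degree below `n + 1`; the missing roots are at infinity and contribute `u = 0`, so
  -- an inequality is enough.
  · have hcard : (s.card : ℝ) ≤ n + 1 := by
      have : s.card ≤ n + 1 := by
        rw [hs, Multiset.card_map]
        exact (card_roots' F).trans hF
      exact_mod_cast this
    have hkey := key ζ hzζ
    rw [← hU] at hkey
    have e1 : (s.sum * starRingEnd ℂ U).re = (n + 1) * Complex.normSq U := by
      rw [hsU, mul_assoc, Complex.mul_conj]
      norm_cast
    have e2 : (ω * starRingEnd ℂ s.sum).im = (n + 1) * (ω * starRingEnd ℂ U).im := by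
      rw [hsU, map_mul, mul_left_comm]
      have : starRingEnd ℂ ((n : ℂ) + 1) = ((n + 1 : ℝ) : ℂ) := by simp
      rw [this, Complex.im_ofReal_mul]
    rw [e1, e2, hkey] at h1
    have hp := Complex.normSq_pos.2 hU0
    have hy : 0 ≤ (ω * z).im - c := by linarith
    have a1 : ((ω * z).im - c) * ((s.card : ℝ) * Complex.normSq U)
        ≤ ((ω * z).im - c) * ((n + 1) * Complex.normSq U) := by gcongr
    have a2 : 0 ≤ ((ω * ζ).im - c) * ((n + 1) * Complex.normSq U) := by
      have : 0 ≤ (ω * ζ).im - c := by linarith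
      positivity
    nlinarith

/-- The polynomial with coefficients `a j` in the binomial basis of degree `k`. -/
noncomputable def binomPoly (k : ℕ) (a : ℕ → ℂ) : ℂ[X] :=
  ∑ j ∈ Finset.range (k + 1), C ((k.choose j : ℂ) * a j) * X ^ j

theorem coeff_binomPoly (k : ℕ) (a : ℕ → ℂ) (j : ℕ) :
    (binomPoly k a).coeff j = (k.choose j : ℂ) * a j := by
  simp only [binomPoly, finsetSum_coeff, coeff_C_mul_X_pow, Finset.sum_ite_eq,
    Finset.mem_range]
  split_ifs with h
  · rfl
  · rw [Nat.choose_eq_zero_of_lt (by omega)]; simp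

theorem natDegree_binomPoly_le (k : ℕ) (a : ℕ → ℂ) : (binomPoly k a).natDegree ≤ k := by
  rw [natDegree_le_iff_coeff_eq_zero]
  intro j hj
  rw [coeff_binomPoly, Nat.choose_eq_zero_of_lt hj]; simp

/-- In binomial coordinates the polar derivative is the shift `a j + ζ * a (j + 1)`, which makes
Laguerre's theorem iterable. -/
theorem binomPoly_polar (n : ℕ) (a : ℕ → ℂ) (ζ : ℂ) :
    C (n + 1 : ℂ) * binomPoly n (fun j => a j + ζ * a (j + 1))
      = C (n + 1 : ℂ) * binomPoly (n + 1) a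
        + (C ζ - X) * (binomPoly (n + 1) a).derivative := by
  ext j
  have h1 : (((n + 1).choose (j + 1) : ℕ) : ℂ) * (j + 1) = (n + 1) * n.choose j := by
    exact_mod_cast (Nat.add_one_mul_choose_eq n j).symm
  rw [sub_mul]
  cases j with
  | zero =>
    simp [coeff_binomPoly, coeff_derivative]
    ring
  | succ i =>
    have h2 : (((n + 1).choose (i + 1) : ℕ) : ℂ) * (i + 1) = (n + 1) * n.choose i := by
      exact_mod_cast (Nat.add_one_mul_choose_eq n i).symm
    have h3 : (((n + 1).choose (i + 1) : ℕ) : ℂ) = n.choose i + n.choose (i + 1) := by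
      exact_mod_cast Nat.choose_succ_succ n i
    simp only [coeff_add, coeff_sub, coeff_C_mul, coeff_X_mul, coeff_binomPoly,
      coeff_derivative] at *
    push_cast at *
    linear_combination (-ζ * a (i + 2)) * h1 + (-(n + 1 : ℂ) * a (i + 1)) * h3 + (a (i + 1)) * h2

/-- Grace–Walsh–Szegő for a closed half-plane, with the symmetric multiaffine form written as the
pairing of the binomial coefficients with the coefficients of `∏ (1 + ζ X)`. -/
theorem sum_prod_one_add_mul_X_ne_zero (ω : ℂ) (c : ℝ) (l : List ℂ)
    (hl : ∀ ζ ∈ l, c ≤ (ω * ζ).im) (hne : ∃ z : ℂ, c ≤ (ω * z).im) (a : ℕ → ℂ)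
    (h : ∀ z : ℂ, c ≤ (ω * z).im → (binomPoly l.length a).eval z ≠ 0) :
    (l.map fun ζ => 1 + C ζ * X).prod.sum (fun j b => b * a j) ≠ 0 := by
  induction l generalizing a with
  | nil =>
    obtain ⟨z, hz⟩ := hne
    simpa [binomPoly, ← C_1, -map_one, sum_C_index] using h z hz
  | cons ζ l ih =>
    -- Multiplication by `1 + ζ X` is adjoint, under the pairing, to the shift in `binomPoly_polar`;
    -- each factor thus costs one polar derivative.
    have hlin : ∀ p : ℂ[X], ((1 + C ζ * X) * p).sum (fun j b => b * a j)
        = p.sum (fun j b => b * (a j + ζ * a (j + 1))) := by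
      intro p
      induction p using Polynomial.induction_on' with
      | add p q hp hq =>
        rw [mul_add, sum_add_index _ _ _ (by simp) (by intros; ring),
          sum_add_index _ _ _ (by simp) (by intros; ring), hp, hq]
      | monomial n b =>
        have : (1 + C ζ * X) * monomial n b = monomial n b + monomial (n + 1) (ζ * b) := by
          rw [add_mul, one_mul, mul_assoc, X_mul_monomial, C_mul_monomial]
        rw [this, sum_add_index _ _ _ (by simp) (by intros; ring), sum_monomial_index _ _ (by simp),
          sum_monomial_index _ _ (by simp), sum_monomial_index _ _ (by simp)]
        ring
    rw [List.map_cons, List.prod_cons, hlin]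
    refine ih (fun ξ hξ => hl ξ (List.mem_cons_of_mem _ hξ)) _ fun z hz h0 => ?_
    have hp := congrArg (eval z) (binomPoly_polar l.length a ζ)
    simp only [eval_mul, eval_C, h0, eval_add, eval_sub, eval_X, mul_zero] at hp
    refine polar_derivative_ne_zero l.length (binomPoly (l.length + 1) a)
      (natDegree_binomPoly_le _ _) ω c h ζ (hl ζ List.mem_cons_self) z hz ?_
    have hn : (l.length + 1 : ℂ) ≠ 0 := by exact_mod_cast l.length.succ_ne_zero
    field_simp
    linear_combination -hp

/-! ### Multiplier transforms of the Schur–Szegő product -/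

theorem coeff_schurSzego (k : ℕ) (P Q : ℝ[X]) (j : ℕ) (hj : j ≤ k) :
    (schurSzego k P Q).coeff j = binomCoeff k P j * Q.coeff j := by
  have h : (k.choose j : ℝ) ≠ 0 := Nat.cast_ne_zero.2 (Nat.choose_pos hj).ne'
  simp only [schurSzego, finsetSum_coeff, coeff_C_mul_X_pow, Finset.sum_ite_eq,
    Finset.mem_range, if_pos (Nat.lt_succ_of_le hj), binomCoeff]
  field_simp

theorem natDegree_schurSzego_le (k : ℕ) (P Q : ℝ[X]) : (schurSzego k P Q).natDegree ≤ k :=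
  natDegree_sum_le_of_forall_le _ _ fun _ hj =>
    (natDegree_C_mul_X_pow_le _ _).trans (Nat.lt_succ_iff.1 (Finset.mem_range.1 hj))

theorem natDegree_schurSzego (k : ℕ) (P Q : ℝ[X]) (hP : P ≠ 0) (hQ : Q ≠ 0)
    (hPdeg : P.natDegree = k) (hQdeg : Q.natDegree = k) : (schurSzego k P Q).natDegree = k := by
  refine le_antisymm (natDegree_schurSzego_le k P Q) (le_natDegree_of_ne_zero ?_)
  have h1 : P.coeff k ≠ 0 := by rw [← hPdeg]; exact leadingCoeff_ne_zero.2 hP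
  have h2 : Q.coeff k ≠ 0 := by rw [← hQdeg]; exact leadingCoeff_ne_zero.2 hQ
  rw [coeff_schurSzego k P Q k le_rfl, binomCoeff]
  simp [h1, h2]

theorem schurSzego_comm (k : ℕ) (P Q : ℝ[X]) : schurSzego k P Q = schurSzego k Q P := by
  simp only [schurSzego, mul_right_comm]

/-- The value at `z` of `P` with its coefficients multiplied by the sequence `m`. -/
noncomputable def multiplierEval (k : ℕ) (P : ℝ[X]) (m : ℕ → ℂ) (z : ℂ) : ℂ :=
  ∑ j ∈ Finset.range (k + 1), (P.coeff j : ℂ) * m j * z ^ j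

theorem eval_map_ofReal_eq_sum (k : ℕ) (P : ℝ[X]) (hP : P.natDegree ≤ k) (z : ℂ) :
    (P.map Complex.ofRealHom).eval z = ∑ j ∈ Finset.range (k + 1), (P.coeff j : ℂ) * z ^ j := by
  rw [eval_eq_sum_range' (n := k + 1) (by
    have := natDegree_map_le (f := Complex.ofRealHom) (p := P); omega)]
  simp

theorem multiplierEval_one (k : ℕ) (P : ℝ[X]) (hP : P.natDegree ≤ k) (z : ℂ) :
    multiplierEval k P (fun _ => 1) z = (P.map Complex.ofRealHom).eval z := by
  simp [multiplierEval, eval_map_ofReal_eq_sum k P hP]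

theorem multiplierEval_pow (k : ℕ) (P : ℝ[X]) (hP : P.natDegree ≤ k) (s q : ℝ) (z : ℂ) :
    multiplierEval k P (fun j => 1 + Complex.I * s * q ^ j) z
      = (P.map Complex.ofRealHom).eval z
        + Complex.I * s * (P.map Complex.ofRealHom).eval (q * z) := by
  rw [eval_map_ofReal_eq_sum k P hP, eval_map_ofReal_eq_sum k P hP, Finset.mul_sum,
    ← Finset.sum_add_distrib, multiplierEval]
  refine Finset.sum_congr rfl fun j _ => ?_
  ring

theorem multiplierEval_natCast (k : ℕ) (P : ℝ[X]) (hP : P.natDegree ≤ k) (s : ℝ) (z : ℂ) :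
    multiplierEval k P (fun j => 1 + Complex.I * s * j) z
      = (P.map Complex.ofRealHom).eval z
        + Complex.I * s * (z * (P.derivative.map Complex.ofRealHom).eval z) := by
  have h : z * (P.derivative.map Complex.ofRealHom).eval z
      = ∑ j ∈ Finset.range (k + 1), (P.coeff j : ℂ) * j * z ^ j := by
    have h1 : (X * P.derivative).natDegree ≤ k := by
      rw [natDegree_le_iff_coeff_eq_zero] at hP ⊢
      intro j hj
      cases j with
      | zero => simp
      | succ j => rw [coeff_X_mul, coeff_derivative, hP _ hj, zero_mul]
    have h2 := eval_map_ofReal_eq_sum k (X * P.derivative) h1 z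
    rw [Polynomial.map_mul, map_X, eval_mul, eval_X] at h2
    rw [h2]
    refine Finset.sum_congr rfl fun j _ => ?_
    cases j with
    | zero => simp
    | succ j => simp [coeff_derivative]
  rw [h, eval_map_ofReal_eq_sum k P hP, Finset.mul_sum, ← Finset.sum_add_distrib, multiplierEval]
  refine Finset.sum_congr rfl fun j _ => ?_
  ring

/-- Exhibits the points `-x / r` as the parameters `ζ` in Grace–Walsh–Szegő. -/
theorem comp_C_mul_X_eq_prod (b : ℝ) (l : List ℝ) (h0 : ∀ r ∈ l, r ≠ 0) (x : ℂ) :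
    ((C b * (l.map fun r => X - C r).prod).map Complex.ofRealHom).comp (C x * X)
      = C (b * (l.map fun r : ℝ => -(r : ℂ)).prod)
        * ((l.map fun r : ℝ => -(x / (r : ℂ))).map fun ζ => 1 + C ζ * X).prod := by
  simp only [Polynomial.map_mul, map_C, mul_comp, C_comp, C_mul, mul_assoc,
    Complex.ofRealHom_eq_coe]
  congr 1
  induction l with
  | nil => simp
  | cons r l ih =>
    have hr : (r : ℂ) ≠ 0 := by exact_mod_cast h0 r (by simp)
    have e : (C x * X - C (r : ℂ) : ℂ[X]) = C (-(r : ℂ)) * (1 + C (-(x / (r : ℂ))) * X) := by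
      rw [mul_add, ← mul_assoc, ← C_mul, neg_mul_neg, mul_div_cancel₀ _ hr]
      simp; ring
    simp only [List.map_cons, List.prod_cons, Polynomial.map_mul, mul_comp, C_mul,
      ih fun r' hr' => h0 r' (List.mem_cons_of_mem _ hr')]
    simp only [Polynomial.map_sub, map_X, map_C, sub_comp, X_comp, C_comp,
      Complex.ofRealHom_eq_coe, e]
    ring

/-- A multiplier transform of the Schur–Szegő product `P * Q` does not vanish at `x` if the same
transform of `P` does not vanish on a closed half-plane containing `-x / r` for the roots `r`
of `Q`. -/
theorem multiplierEval_schurSzego_ne_zero (k : ℕ) (P Q : ℝ[X]) (hQ : Q.Splits)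
    (hQdeg : Q.natDegree = k) (hQ0 : Q ≠ 0) (h0 : ∀ r ∈ Q.roots, r ≠ 0) (m : ℕ → ℂ) (ω : ℂ) (c : ℝ)
    (hk : k ≠ 0) (x : ℂ) (hx : ∀ r ∈ Q.roots, c ≤ (ω * -(x / (r : ℂ))).im)
    (h : ∀ z : ℂ, c ≤ (ω * z).im → multiplierEval k P m z ≠ 0) :
    multiplierEval k (schurSzego k P Q) m x ≠ 0 := by
  have hd := comp_C_mul_X_eq_prod Q.leadingCoeff Q.roots.toList
    (fun r hr => h0 r (Multiset.mem_toList.1 hr)) x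
  have hfac : C Q.leadingCoeff * (Q.roots.toList.map fun r => X - C r).prod = Q := by
    conv_rhs => rw [hQ.eq_prod_roots]
    rw [← Multiset.prod_coe, ← Multiset.map_coe, Multiset.coe_toList]
  rw [hfac] at hd
  generalize (Q.leadingCoeff : ℂ) * (Q.roots.toList.map fun r : ℝ => -(r : ℂ)).prod = d at hd
  have hcard : Q.roots.toList.length = k := by
    rw [Multiset.length_toList, ← hQdeg, hQ.natDegree_eq_card_roots]
  set l := Q.roots.toList.map fun r : ℝ => -(x / (r : ℂ)) with hl
  set a : ℕ → ℂ := fun j => (binomCoeff k P j : ℂ) * m j with ha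
  have hd0 : d ≠ 0 := by
    rintro rfl
    have h1 := congrArg (eval 0) hd
    simp only [eval_comp, eval_mul, eval_C, eval_X, mul_zero, zero_mul] at h1
    have h2 : ((Q.eval 0 : ℝ) : ℂ) = 0 := by
      rw [← h1, ← coeff_zero_eq_eval_zero, ← coeff_zero_eq_eval_zero, coeff_map]
      rfl
    exact h0 0 ((mem_roots hQ0).2 (by exact_mod_cast h2)) rfl
  have key := sum_prod_one_add_mul_X_ne_zero ω c l
    (by
      intro ζ hζ
      obtain ⟨r, hr, rfl⟩ := List.mem_map.1 hζ
      exact hx r (Multiset.mem_toList.1 hr))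
    (by
      have : Q.roots ≠ 0 := hQ.roots_ne_zero (by omega)
      obtain ⟨r, hr⟩ := Multiset.exists_mem_of_ne_zero this
      exact ⟨_, hx r hr⟩) a
    (by
      intro z hz
      have := h z hz
      rw [hl, List.length_map, hcard]
      convert this using 1
      rw [eval_eq_sum_range' (Nat.lt_succ_of_le (natDegree_binomPoly_le k a)), multiplierEval]
      refine Finset.sum_congr rfl fun j hj => ?_
      have hc : (k.choose j : ℂ) ≠ 0 :=
        Nat.cast_ne_zero.2 (Nat.choose_pos (Nat.lt_succ_iff.1 (Finset.mem_range.1 hj))).ne'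
      rw [coeff_binomPoly, ha]
      simp only [binomCoeff, Complex.ofReal_div, Complex.ofReal_natCast]
      field_simp)
  have hsum : ((Q.map Complex.ofRealHom).comp (C x * X)).sum (fun j b => b * a j)
      = multiplierEval k (schurSzego k P Q) m x := by
    rw [sum_over_range' _ (by simp) (k + 1), multiplierEval]
    · refine Finset.sum_congr rfl fun j hj => ?_
      rw [coeff_schurSzego k P Q j (Nat.lt_succ_iff.1 (Finset.mem_range.1 hj)),
        comp_C_mul_X_coeff, coeff_map, ha]
      simp only [Complex.ofRealHom_eq_coe, Complex.ofReal_mul]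
      ring
    · refine Nat.lt_succ_of_le (natDegree_comp_le.trans ?_)
      calc _ ≤ k * 1 := Nat.mul_le_mul (natDegree_map_le.trans hQdeg.le) ((natDegree_C_mul_le x X).trans natDegree_X_le)
        _ = k := mul_one k
  rw [← hsum, hd, ← smul_eq_C_mul, sum_smul_index _ _ _ (by simp)]
  simp only [mul_assoc]
  rw [Polynomial.sum, ← Finset.mul_sum]
  exact mul_ne_zero hd0 key

/-! ### Arguments of dilated products -/

/-- The sine of the difference of the arguments has the sign of `Im((z + a) conj(z + b)) = (b - a)
Im z`. -/
theorem arg_add_lt_arg_add {z : ℂ} (hz : 0 < z.im) {a b : ℝ} (hab : a < b) :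
    (z + b).arg < (z + a).arg := by
  by_contra! hle
  have hb := Complex.arg_le_pi (z + b)
  have ha : 0 ≤ (z + a).arg := Complex.arg_nonneg_iff.2 (by simpa using hz.le)
  have hsin : Real.sin ((z + a).arg - (z + b).arg) ≤ 0 :=
    Real.sin_nonpos_of_nonpos_of_neg_pi_le (by linarith) (by linarith)
  have e : ((z + a).im * (z + b).re - (z + a).re * (z + b).im)
      = ‖z + a‖ * ‖z + b‖ * Real.sin ((z + a).arg - (z + b).arg) := by
    rw [Real.sin_sub, ← Complex.norm_mul_cos_arg (z + a), ← Complex.norm_mul_cos_arg (z + b),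
      ← Complex.norm_mul_sin_arg (z + a), ← Complex.norm_mul_sin_arg (z + b)]
    ring
  have h1 : ‖z + a‖ * ‖z + b‖ * Real.sin ((z + a).arg - (z + b).arg) ≤ 0 :=
    mul_nonpos_of_nonneg_of_nonpos (by positivity) hsin
  rw [← e] at h1
  simp at h1
  nlinarith

/-- Each factor has argument `arg(z + v/q) - arg(z + v)`, the length of an interval. Since `q u < v`
means `u < v/q`, these intervals are disjoint, and they lie between `0` and `arg(z + u/q)`, `u`
being the smallest entry. -/
theorem exists_polar_prod_dilate (q : ℝ) (hq : 1 < q) {z : ℂ} (hz : 0 < z.im) (l : List ℝ) (u : ℝ)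
    (hpos : ∀ v ∈ u :: l, 0 < v) (hl : (u :: l).Pairwise fun u v => q * u < v) :
    ∃ r φ : ℝ, 0 < r ∧ 0 < φ ∧ φ < (z + (u / q : ℝ)).arg ∧
      ((u :: l).map fun v : ℝ => (q * z + v) * starRingEnd ℂ (z + v)).prod
        = r * Complex.exp (φ * Complex.I) := by
  have hq0 : 0 < q := by linarith
  have hpolar : ∀ v : ℝ, 0 < v → ∃ r : ℝ, 0 < r ∧ (q * z + v) * starRingEnd ℂ (z + v)
      = r * Complex.exp (((z + (v / q : ℝ)).arg - (z + v).arg : ℝ) * Complex.I) := by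
    intro v hv
    have hne : ∀ a : ℝ, z + a ≠ 0 := by
      intro a h
      have := congrArg Complex.im h
      simp at this
      exact hz.ne' this
    refine ⟨q * (‖z + (v / q : ℝ)‖ * ‖z + v‖), ?_, ?_⟩
    · have := norm_pos_iff.2 (hne v)
      have := norm_pos_iff.2 (hne (v / q))
      positivity
    · have e1 : q * z + v = q * (z + (v / q : ℝ)) := by
        have : (q : ℂ) ≠ 0 := by exact_mod_cast hq0.ne'
        push_cast
        field_simp
      have e2 : starRingEnd ℂ (z + v) = ‖z + v‖ * Complex.exp (-((z + v).arg * Complex.I)) := by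
        conv_lhs => rw [← Complex.norm_mul_exp_arg_mul_I (z + v)]
        rw [map_mul, Complex.conj_ofReal, ← Complex.exp_conj, map_mul, Complex.conj_ofReal,
          Complex.conj_I, mul_neg]
      rw [e1, e2]
      conv_lhs => rw [← Complex.norm_mul_exp_arg_mul_I (z + (v / q : ℝ))]
      push_cast
      rw [sub_mul, sub_eq_add_neg, Complex.exp_add]
      ring
  have hu : 0 < u := hpos u (by simp)
  have hargpos : 0 < (z + u).arg := by
    have h1 := arg_add_lt_arg_add hz (show u < u + 1 by linarith)
    have h2 : 0 ≤ (z + (u + 1 : ℝ)).arg := Complex.arg_nonneg_iff.2 (by simpa using hz.le)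
    linarith
  have hlt := arg_add_lt_arg_add hz (div_lt_self hu hq)
  obtain ⟨r, hr, e⟩ := hpolar u hu
  induction l generalizing u r with
  | nil =>
    refine ⟨r, _, hr, sub_pos.2 hlt, ?_, by simpa using e⟩
    linarith
  | cons v l ih =>
    have hv : 0 < v := hpos v (by simp)
    have huv : q * u < v := (List.pairwise_cons.1 hl).1 v (by simp)
    have hargv : 0 < (z + v).arg := by
      have h1 := arg_add_lt_arg_add hz (show v < v + 1 by linarith)
      have h2 : 0 ≤ (z + (v + 1 : ℝ)).arg := Complex.arg_nonneg_iff.2 (by simpa using hz.le)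
      linarith
    obtain ⟨r', hr', e'⟩ := hpolar v hv
    obtain ⟨r₂, φ, hr₂, hφ, hφlt, e₂⟩ := ih v (fun w hw => hpos w (List.mem_cons_of_mem _ hw))
      (List.pairwise_cons.1 hl).2 hv hargv (arg_add_lt_arg_add hz (div_lt_self hv hq)) r' hr' e'
    have hvq : (z + (v / q : ℝ)).arg < (z + u).arg :=
      arg_add_lt_arg_add hz (by rw [lt_div_iff₀ hq0]; linarith)
    refine ⟨r * r₂, (z + (u / q : ℝ)).arg - (z + u).arg + φ, by positivity, by linarith,
      by linarith, ?_⟩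
    rw [List.map_cons, List.prod_cons, e, e₂]
    rw [Complex.ofReal_add _ φ, add_mul, Complex.exp_add]
    push_cast
    ring

theorem im_prod_dilate_pos (q : ℝ) (hq : 1 < q) {z : ℂ} (hz : 0 < z.im) (l : List ℝ) (hne : l ≠ [])
    (hpos : ∀ v ∈ l, 0 < v) (hl : l.Pairwise fun u v => q * u < v) :
    0 < (l.map fun v : ℝ => (q * z + v) * starRingEnd ℂ (z + v)).prod.im := by
  cases l with
  | nil => exact absurd rfl hne
  | cons u l =>
    obtain ⟨r, φ, hr, hφ, hlt, e⟩ := exists_polar_prod_dilate q hq hz l u hpos hl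
    rw [e, Complex.im_ofReal_mul, Complex.exp_ofReal_mul_I_im]
    exact mul_pos hr (Real.sin_pos_of_pos_of_lt_pi hφ (hlt.trans_le (Complex.arg_le_pi _)))

theorem im_prod_dilate_sign (q : ℝ) (hq : 1 < q) {z : ℂ} (hz : 0 < z.im) (l : List ℝ) (hne : l ≠ [])
    (hpos : ∀ v ∈ l, 0 < v) (hl : l.Pairwise fun u v => q * u < v) (τ : ℝ) (hτ : τ = 1 ∨ τ = -1) :
    τ * (l.map fun v : ℝ => (q * z - τ * v) * starRingEnd ℂ (z - τ * v)).prod.im < 0 := by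
  rcases hτ with rfl | rfl
  -- Reflection in the imaginary axis preserves the upper half-plane and swaps the two signs.
  · have h := im_prod_dilate_pos q hq (z := -starRingEnd ℂ z) (by simpa using hz) l hne hpos hl
    have e : (l.map fun v : ℝ => (q * z - (1 : ℝ) * v) * starRingEnd ℂ (z - (1 : ℝ) * v)).prod
        = starRingEnd ℂ (l.map fun v : ℝ =>
          (q * -starRingEnd ℂ z + v) * starRingEnd ℂ (-starRingEnd ℂ z + v)).prod := by
      rw [map_list_prod, List.map_map]
      congr 1
      refine List.map_congr_left fun v _ => ?_
      simp
      ring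
    rw [e, Complex.conj_im]
    linarith
  · have h := im_prod_dilate_pos q hq hz l hne hpos hl
    simp only [Complex.ofReal_neg, Complex.ofReal_one, neg_mul, one_mul, sub_neg_eq_add]
    linarith

/-! ### Signs and sorted moduli of the roots -/

theorem HasRealRootsOfSameSign.exists_sign {P : ℝ[X]} (hP : HasRealRootsOfSameSign P) :
    ∃ τ : ℝ, (τ = 1 ∨ τ = -1) ∧ ∀ x ∈ P.roots, 0 < τ * x := by
  rcases hP.same_sign with h | h
  · exact ⟨1, Or.inl rfl, fun x hx => by simpa using h x hx⟩
  · exact ⟨-1, Or.inr rfl, fun x hx => by simpa using h x hx⟩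

theorem map_rootModuli {P : ℝ[X]} {τ : ℝ} (hτ : τ = 1 ∨ τ = -1)
    (h : ∀ x ∈ P.roots, 0 < τ * x) :
    (((rootModuli P).map fun u => τ * u : List ℝ) : Multiset ℝ) = P.roots := by
  rw [← Multiset.map_coe, rootModuli, Multiset.sort_eq, Multiset.map_map]
  conv_rhs => rw [← Multiset.map_id P.roots]
  refine Multiset.map_congr rfl fun x hx => ?_
  have := h x hx
  rcases hτ with rfl | rfl
  · simp only [Function.comp, id]
    rw [abs_of_pos (by linarith)]; ring
  · simp only [Function.comp, id]
    rw [abs_of_neg (by linarith)]; ring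

theorem rootModuli_pos {P : ℝ[X]} (h : ∀ x ∈ P.roots, x ≠ 0) : ∀ u ∈ rootModuli P, 0 < u := by
  intro u hu
  rw [rootModuli, ← Multiset.mem_coe, Multiset.sort_eq] at hu
  obtain ⟨x, hx, rfl⟩ := Multiset.mem_map.1 hu
  exact abs_pos.2 (h x hx)

theorem length_rootModuli {P : ℝ[X]} (hP : P.Splits) : (rootModuli P).length = P.natDegree := by
  rw [rootModuli, Multiset.length_sort, Multiset.card_map, hP.natDegree_eq_card_roots]

theorem pairwise_rootModuli_of_lt_lmesh {P : ℝ[X]} (h0 : ∀ x ∈ P.roots, x ≠ 0) {q : ℝ}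
    (hq : q < lmesh P) : (rootModuli P).Pairwise fun u v => q * u < v := by
  have hsort : (rootModuli P).Pairwise (· ≤ ·) := Multiset.pairwise_sort _ _
  rw [List.pairwise_iff_getElem] at hsort ⊢
  intro i j hi hj hij
  have hle : (rootModuli P)[i + 1] ≤ (rootModuli P)[j] := by
    rcases (Nat.succ_le_of_lt hij).eq_or_lt with h | h
    · simp only [← h, Nat.succ_eq_add_one, le_refl]
    · exact hsort _ _ _ hj h
  refine lt_of_lt_of_le ?_ hle
  rw [← lt_div_iff₀ (rootModuli_pos h0 _ (List.getElem_mem hi))]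
  exact hq.trans_le (ciInf_le (Set.finite_range _).bddBelow
    (⟨i, by omega⟩ : Fin ((rootModuli P).length - 1)))

theorem map_ofReal_eval_eq_prod {P : ℝ[X]} (hP : P.Splits) {τ : ℝ} (hτ : τ = 1 ∨ τ = -1)
    (h : ∀ x ∈ P.roots, 0 < τ * x) (z : ℂ) :
    (P.map Complex.ofRealHom).eval z
      = P.leadingCoeff * ((rootModuli P).map fun u : ℝ => z - τ * u).prod := by
  conv_lhs => rw [hP.eq_prod_roots, ← map_rootModuli hτ h]
  generalize rootModuli P = l
  simp only [Multiset.map_coe, Multiset.prod_coe, List.map_map]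
  rw [Polynomial.map_mul, Polynomial.map_list_prod, eval_mul, eval_list_prod, List.map_map,
    List.map_map]
  simp [Function.comp_def]

theorem eval_map_ofReal_real (P : ℝ[X]) (x : ℝ) :
    (P.map Complex.ofRealHom).eval (x : ℂ) = ((P.eval x : ℝ) : ℂ) :=
  eval_map_apply Complex.ofRealHom x

theorem exists_mem_roots_of_eval_map_ofReal_eq_zero {P : ℝ[X]} (hP : P.Splits) (hP0 : P ≠ 0) {z : ℂ}
    (hz : (P.map Complex.ofRealHom).eval z = 0) : ∃ r ∈ P.roots, (r : ℂ) = z := by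
  have h1 : z ∈ (P.map Complex.ofRealHom).roots :=
    (mem_roots (Polynomial.map_ne_zero hP0)).2 hz
  rw [hP.roots_map, Multiset.mem_map] at h1
  exact h1

theorem eq_zero_of_ofReal_add_I_mul {x y s : ℝ} (hs : s = 1 ∨ s = -1)
    (h : (x : ℂ) + Complex.I * s * y = 0) : x = 0 ∧ y = 0 := by
  have h1 := congrArg Complex.re h
  have h2 := congrArg Complex.im h
  rcases hs with rfl | rfl <;> simp at h1 h2 <;> exact ⟨h1, h2⟩

/-! ### Zero-free upper half-planes -/

/-- A Hermite–Biehler type statement for `P(z)` and `P(qz)`. -/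
theorem multiplierEval_pow_ne_zero {P : ℝ[X]} (hP : P.Splits) (hP0 : P ≠ 0)
    (hdeg : P.natDegree ≠ 0) {τ : ℝ} (hτ : τ = 1 ∨ τ = -1)
    (h : ∀ x ∈ P.roots, 0 < τ * x) {q : ℝ} (hq : 1 < q) (hl : q < lmesh P) (z : ℂ)
    (hz : 0 ≤ z.im) :
    multiplierEval P.natDegree P (fun j => 1 + Complex.I * τ * q ^ j) z ≠ 0 := by
  rw [multiplierEval_pow _ _ le_rfl]
  intro hzero
  have hne0 : ∀ x ∈ P.roots, x ≠ 0 := by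
    rintro x hx rfl
    simpa using h 0 hx
  have hpos := rootModuli_pos hne0
  have hpw := pairwise_rootModuli_of_lt_lmesh hne0 hl
  rcases hz.eq_or_lt with hz0 | hz0
  · obtain ⟨x, rfl⟩ : ∃ x : ℝ, (x : ℂ) = z := ⟨z.re, Complex.ext rfl (by simpa using hz0)⟩
    rw [← Complex.ofReal_mul, eval_map_ofReal_real, eval_map_ofReal_real] at hzero
    obtain ⟨h1, h2⟩ := eq_zero_of_ofReal_add_I_mul hτ hzero
    have hmem : ∀ y, P.eval y = 0 → ∃ u ∈ rootModuli P, τ * u = y := by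
      intro y hy
      have hy' : y ∈ P.roots := (mem_roots hP0).2 hy
      rw [← map_rootModuli hτ h, Multiset.mem_coe, List.mem_map] at hy'
      exact hy'
    obtain ⟨u, hu, rfl⟩ := hmem _ h1
    obtain ⟨v, hv, hvu⟩ := hmem _ h2
    have hτ0 : τ ≠ 0 := by rcases hτ with rfl | rfl <;> norm_num
    have hvu' : v = q * u := mul_left_cancel₀ hτ0 (by rw [hvu]; ring)
    have hu0 := hpos u hu
    have hne : u ≠ v := by rw [hvu']; nlinarith
    have hget := List.pairwise_iff_getElem.1 hpw
    obtain ⟨i, hi, rfl⟩ := List.mem_iff_getElem.1 hu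
    obtain ⟨j, hj, rfl⟩ := List.mem_iff_getElem.1 hv
    rcases lt_trichotomy i j with hij | rfl | hij
    · exact absurd (hget i j hi hj hij) (by rw [hvu']; exact lt_irrefl _)
    · exact hne rfl
    · have := hget j i hj hi hij
      rw [hvu'] at this
      nlinarith [mul_pos hu0 (sub_pos.2 hq), mul_pos (mul_pos hu0 (sub_pos.2 hq)) (sub_pos.2 hq)]
  · have hne : rootModuli P ≠ [] := by
      rw [← List.length_pos_iff_ne_nil, length_rootModuli hP]; omega
    have him := im_prod_dilate_sign q hq hz0 _ hne hpos hpw τ hτ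
    rw [map_ofReal_eval_eq_prod hP hτ h, map_ofReal_eval_eq_prod hP hτ h] at hzero
    rw [List.prod_map_mul] at him
    have hconj : ((rootModuli P).map fun v : ℝ => starRingEnd ℂ (z - τ * v)).prod
        = starRingEnd ℂ ((rootModuli P).map fun v : ℝ => z - τ * v).prod := by
      rw [map_list_prod, List.map_map]; rfl
    rw [hconj] at him
    set A := ((rootModuli P).map fun v : ℝ => z - τ * v).prod
    set B := ((rootModuli P).map fun v : ℝ => q * z - τ * v).prod
    have hlc : (P.leadingCoeff : ℂ) ≠ 0 := by exact_mod_cast leadingCoeff_ne_zero.2 hP0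
    have hA : A = -(Complex.I * τ * B) := by
      have : (P.leadingCoeff : ℂ) * (A + Complex.I * τ * B) = 0 := by
        rw [← hzero]; ring
      have := (mul_eq_zero.1 this).resolve_left hlc
      linear_combination this
    -- A zero gives `τ Im(B Ā) = |B|² ≥ 0`, against the strict sign in `him`.
    have e : B * starRingEnd ℂ A = ((τ * Complex.normSq B : ℝ) : ℂ) * Complex.I := by
      rw [hA, Complex.ofReal_mul, ← Complex.mul_conj]
      simp only [map_neg, map_mul, Complex.conj_I, Complex.conj_ofReal]
      ring
    rw [e, Complex.im_ofReal_mul, Complex.I_im] at him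
    have := Complex.normSq_nonneg B
    rcases hτ with rfl | rfl <;> linarith

/-- Termwise, `Im(z / (z - r)) = -r Im z / |z - r|²`. -/
theorem sign_mul_im_sum_neg {z : ℂ} (hz : 0 < z.im) (τ : ℝ) (s : Multiset ℝ) (hs : s ≠ 0)
    (h : ∀ r ∈ s, 0 < τ * r) : τ * (s.map fun r : ℝ => z / (z - r)).sum.im < 0 := by
  have hterm : ∀ r : ℝ, 0 < τ * r → τ * (z / (z - r)).im < 0 := by
    intro r hr
    have hne : z - r ≠ 0 := by
      intro e
      have := congrArg Complex.im e
      simp at this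
      exact hz.ne' this
    have hp := Complex.normSq_pos.2 hne
    have e : τ * (z / (z - r)).im = -(z.im * (τ * r)) / Complex.normSq (z - r) := by
      rw [Complex.div_im]
      simp only [Complex.sub_re, Complex.sub_im, Complex.ofReal_re, Complex.ofReal_im]
      field_simp
      ring
    rw [e]
    exact div_neg_of_neg_of_pos (neg_neg_of_pos (mul_pos hz hr)) hp
  induction s using Multiset.induction with
  | empty => exact absurd rfl hs
  | cons r s ih =>
    have h1 := hterm r (h r (Multiset.mem_cons_self r s))
    rw [Multiset.map_cons, Multiset.sum_cons, Complex.add_im, mul_add]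
    rcases eq_or_ne s 0 with rfl | hs'
    · simpa using h1
    · linarith [ih hs' fun v hv => h v (Multiset.mem_cons_of_mem hv)]

/-- A Hermite–Biehler type statement for `P(z)` and `z P'(z)`. -/
theorem multiplierEval_natCast_ne_zero {P : ℝ[X]} (hP : P.Splits) (hP0 : P ≠ 0)
    (hdeg : P.natDegree ≠ 0) {τ : ℝ} (hτ : τ = 1 ∨ τ = -1)
    (h : ∀ x ∈ P.roots, 0 < τ * x) (hnd : P.roots.Nodup) (z : ℂ) (hz : 0 ≤ z.im) :
    multiplierEval P.natDegree P (fun j => 1 + Complex.I * τ * j) z ≠ 0 := by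
  rw [multiplierEval_natCast _ _ le_rfl]
  intro hzero
  rcases hz.eq_or_lt with hz0 | hz0
  · obtain ⟨x, rfl⟩ : ∃ x : ℝ, (x : ℂ) = z := ⟨z.re, Complex.ext rfl (by simpa using hz0)⟩
    rw [eval_map_ofReal_real, eval_map_ofReal_real, ← Complex.ofReal_mul] at hzero
    obtain ⟨h1, h2⟩ := eq_zero_of_ofReal_add_I_mul hτ hzero
    have hx : x ∈ P.roots := (mem_roots hP0).2 h1
    have hx0 : x ≠ 0 := by
      rintro rfl
      simpa using h 0 hx
    have h3 : 1 < P.rootMultiplicity x :=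
      (one_lt_rootMultiplicity_iff_isRoot hP0).2 ⟨h1, (mul_eq_zero.1 h2).resolve_left hx0⟩
    rw [← count_roots] at h3
    exact absurd (Multiset.nodup_iff_count_le_one.1 hnd x) (by omega)
  · have hne : (P.map Complex.ofRealHom).eval z ≠ 0 := by
      intro h0
      obtain ⟨r, -, rfl⟩ := exists_mem_roots_of_eval_map_ofReal_eq_zero hP hP0 h0
      simp at hz0
    have hd := (hP.map Complex.ofRealHom).eval_derivative_div_eval_of_ne_zero hne
    rw [hP.roots_map, Multiset.map_map, derivative_map] at hd
    have him := sign_mul_im_sum_neg hz0 τ P.roots (hP.roots_ne_zero hdeg) h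
    have e : (P.roots.map fun r : ℝ => z / (z - r)).sum
        = z * ((P.derivative.map Complex.ofRealHom).eval z
          / (P.map Complex.ofRealHom).eval z) := by
      rw [hd, ← Multiset.sum_map_mul_left]
      simp [div_eq_mul_inv]
    -- A zero forces the logarithmic derivative `z P'/P` to be `iτ`, whose imaginary part has the
    -- wrong sign.
    have hW : z * ((P.derivative.map Complex.ofRealHom).eval z
          / (P.map Complex.ofRealHom).eval z) = (τ : ℂ) * Complex.I := by
      have hττ : (τ : ℂ) * τ = 1 := by rcases hτ with rfl | rfl <;> norm_num
      rw [mul_div_assoc', div_eq_iff hne]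
      linear_combination (-(τ : ℂ) * Complex.I) * hzero
        + (z * (P.derivative.map Complex.ofRealHom).eval z) * (τ : ℂ) * τ * Complex.I_sq
        - (z * (P.derivative.map Complex.ofRealHom).eval z) * hττ
    rw [e, hW, Complex.im_ofReal_mul, Complex.I_im] at him
    rcases hτ with rfl | rfl <;> linarith

/-! ### Roots and mesh of the product -/

theorem im_eq_zero_of_eval_schurSzego_eq_zero {k : ℕ} (hk : k ≠ 0) {P Q : ℝ[X]}
    (hPdeg : P.natDegree = k) (hQdeg : Q.natDegree = k)
    (hP : HasRealRootsOfSameSign P) (hQ : HasRealRootsOfSameSign Q) {z : ℂ}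
    (hz : ((schurSzego k P Q).map Complex.ofRealHom).eval z = 0) : z.im = 0 := by
  by_contra hne
  obtain ⟨τ, hτ, h⟩ := hQ.exists_sign
  have hττ : τ * τ = 1 := by rcases hτ with rfl | rfl <;> norm_num
  obtain ⟨B, hB⟩ : ∃ B : ℝ, ∀ r ∈ Q.roots, τ * r ≤ B := by
    obtain ⟨B, hB⟩ := (Q.roots.toFinset.finite_toSet.image fun r => τ * r).bddAbove
    exact ⟨B, fun r hr => hB ⟨r, by simpa using hr, rfl⟩⟩
  have hsq : 0 < z.im ^ 2 := by positivity
  have hB0 : 0 < B := by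
    obtain ⟨r, hr⟩ := Multiset.exists_mem_of_ne_zero (hQ.real_rooted.roots_ne_zero (by omega))
    exact (h r hr).trans_le (hB r hr)
  -- For nonreal `z` all `-z / r` lie strictly on one side of the real axis, at height at least `|Im
  -- z| / B`. With `c = (Im z)² / B > 0` the half-plane misses the real axis, hence the roots of
  -- `P`.
  refine multiplierEval_schurSzego_ne_zero k P Q hQ.real_rooted hQdeg hQ.ne_zero ?_ (fun _ => 1)
    ((-(z.im * τ) : ℝ) : ℂ) (z.im ^ 2 / B) hk z ?_ ?_
    ((multiplierEval_one k _ (natDegree_schurSzego_le k P Q) z).trans hz)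
  · rintro r hr rfl
    simpa using h 0 hr
  · intro r hr
    have hr0 := h r hr
    have e : (((-(z.im * τ) : ℝ) : ℂ) * -(z / (r : ℂ))).im = z.im ^ 2 / (τ * r) := by
      have hτ0 : τ ≠ 0 := by rintro rfl; simp at hr0
      have hr1 : r ≠ 0 := by rintro rfl; simp at hr0
      rw [Complex.im_ofReal_mul, Complex.neg_im, Complex.div_ofReal_im]
      field_simp
      linear_combination hττ
    rw [e]
    exact div_le_div_of_nonneg_left hsq.le hr0 (hB r hr)
  · intro w hw h0
    rw [multiplierEval_one k _ hPdeg.le] at h0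
    obtain ⟨r, -, rfl⟩ :=
      exists_mem_roots_of_eval_map_ofReal_eq_zero hP.real_rooted hP.ne_zero h0
    rw [Complex.im_ofReal_mul, Complex.ofReal_im, mul_zero] at hw
    exact absurd hw (not_le.2 (by positivity))

theorem splits_schurSzego {k : ℕ} (hk : k ≠ 0) {P Q : ℝ[X]}
    (hPdeg : P.natDegree = k) (hQdeg : Q.natDegree = k)
    (hP : HasRealRootsOfSameSign P) (hQ : HasRealRootsOfSameSign Q) :
    (schurSzego k P Q).Splits := by
  refine Splits.of_splits_map Complex.ofRealHom (IsAlgClosed.splits _) fun z hz => ?_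
  have := im_eq_zero_of_eval_schurSzego_eq_zero hk hPdeg hQdeg hP hQ (mem_roots'.1 hz).2
  exact ⟨z.re, Complex.ext rfl (by simpa using this.symm)⟩

theorem sign_of_eval_schurSzego_eq_zero {k : ℕ} (hk : k ≠ 0) {P Q : ℝ[X]}
    (hPdeg : P.natDegree = k) (hQdeg : Q.natDegree = k)
    (hP : HasRealRootsOfSameSign P) (hQ : HasRealRootsOfSameSign Q) {σ τ : ℝ}
    (hσ : ∀ x ∈ P.roots, 0 < σ * x) (hτ : ∀ x ∈ Q.roots, 0 < τ * x) (hττ : τ * τ = 1) {x : ℝ}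
    (hx : (schurSzego k P Q).eval x = 0) : 0 < -(σ * τ) * x := by
  by_contra! hneg
  -- The half-plane is `σ Re w ≤ 0`, which contains no root of `P`.
  refine multiplierEval_schurSzego_ne_zero k P Q hQ.real_rooted hQdeg hQ.ne_zero ?_ (fun _ => 1)
    ((-σ : ℝ) * Complex.I) 0 hk x ?_ ?_
    ((multiplierEval_one k _ (natDegree_schurSzego_le k P Q) x).trans ?_)
  · rintro r hr rfl
    simpa using hτ 0 hr
  · intro r hr
    have hr0 := hτ r hr
    have e : (((-σ : ℝ) : ℂ) * Complex.I * -((x : ℂ) / (r : ℂ))).im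
        = (σ * τ * x) / (τ * r) := by
      have hτ0 : τ ≠ 0 := by rintro rfl; simp at hr0
      have hr1 : r ≠ 0 := by rintro rfl; simp at hr0
      rw [← Complex.ofReal_div, ← Complex.ofReal_neg, mul_right_comm, ← Complex.ofReal_mul,
        Complex.im_ofReal_mul, Complex.I_im]
      field_simp
    rw [e]
    exact div_nonneg (by linarith) hr0.le
  · intro w hw h0
    rw [multiplierEval_one k _ hPdeg.le] at h0
    obtain ⟨r, hr, rfl⟩ :=
      exists_mem_roots_of_eval_map_ofReal_eq_zero hP.real_rooted hP.ne_zero h0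
    rw [mul_right_comm, ← Complex.ofReal_mul, Complex.im_ofReal_mul, Complex.I_im] at hw
    linarith [hσ r hr]
  · rw [eval_map_ofReal_real, hx, Complex.ofReal_zero]

theorem HasRealRootsOfSameSign.schurSzego {k : ℕ} (hk : k ≠ 0) {P Q : ℝ[X]}
    (hPdeg : P.natDegree = k) (hQdeg : Q.natDegree = k)
    (hP : HasRealRootsOfSameSign P) (hQ : HasRealRootsOfSameSign Q) :
    HasRealRootsOfSameSign (schurSzego k P Q) := by
  refine ⟨?_, splits_schurSzego hk hPdeg hQdeg hP hQ, ?_⟩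
  · intro h0
    have := natDegree_schurSzego k P Q hP.ne_zero hQ.ne_zero hPdeg hQdeg
    rw [h0, natDegree_zero] at this
    exact hk this.symm
  · obtain ⟨σ, hσ', hσ⟩ := hP.exists_sign
    obtain ⟨τ, hτ', hτ⟩ := hQ.exists_sign
    have key : ∀ x ∈ (_root_.schurSzego k P Q).roots, 0 < -(σ * τ) * x := fun x hx =>
      sign_of_eval_schurSzego_eq_zero hk hPdeg hQdeg hP hQ hσ hτ
        (by rcases hτ' with rfl | rfl <;> norm_num) (mem_roots'.1 hx).2
    rcases hσ' with rfl | rfl <;> rcases hτ' with rfl | rfl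
    · exact Or.inr fun x hx => by linarith [key x hx]
    · exact Or.inl fun x hx => by linarith [key x hx]
    · exact Or.inl fun x hx => by linarith [key x hx]
    · exact Or.inr fun x hx => by linarith [key x hx]

theorem multiplierEval_schurSzego_ofReal_ne_zero {k : ℕ} (hk : k ≠ 0) {P Q : ℝ[X]}
    (hQdeg : Q.natDegree = k) (hQ : HasRealRootsOfSameSign Q) (m : ℕ → ℂ)
    (h : ∀ z : ℂ, 0 ≤ z.im → multiplierEval k P m z ≠ 0) (x : ℝ) :
    multiplierEval k (schurSzego k P Q) m x ≠ 0 := by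
  refine multiplierEval_schurSzego_ne_zero k P Q hQ.real_rooted hQdeg hQ.ne_zero ?_ m 1 0 hk x ?_ ?_
  · obtain ⟨τ, -, hτ⟩ := hQ.exists_sign
    rintro r hr rfl
    simpa using hτ 0 hr
  · intro r _
    rw [one_mul, ← Complex.ofReal_div, ← Complex.ofReal_neg, Complex.ofReal_im]
  · intro z hz
    exact h z (by simpa using hz)

theorem schurSzego_eval_mul_ne_zero {k : ℕ} (hk : k ≠ 0) {P Q : ℝ[X]}
    (hPdeg : P.natDegree = k) (hQdeg : Q.natDegree = k)
    (hP : HasRealRootsOfSameSign P) (hQ : HasRealRootsOfSameSign Q) {q : ℝ} (hq : 1 < q)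
    (hl : q < lmesh P) {x : ℝ} (hx : (schurSzego k P Q).eval x = 0) :
    (schurSzego k P Q).eval (q * x) ≠ 0 := by
  intro hqx
  obtain ⟨σ, hσ', hσ⟩ := hP.exists_sign
  subst hPdeg
  have := multiplierEval_schurSzego_ofReal_ne_zero hk hQdeg hQ _
    (fun z hz => multiplierEval_pow_ne_zero hP.real_rooted hP.ne_zero hk hσ' hσ hq hl z hz) x
  rw [multiplierEval_pow _ _ (natDegree_schurSzego_le _ P Q), ← Complex.ofReal_mul,
    eval_map_ofReal_real, eval_map_ofReal_real, hx, hqx] at this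
  simp at this

theorem nodup_roots_schurSzego {k : ℕ} (hk : k ≠ 0) {P Q : ℝ[X]}
    (hPdeg : P.natDegree = k) (hQdeg : Q.natDegree = k)
    (hP : HasRealRootsOfSameSign P) (hQ : HasRealRootsOfSameSign Q) (hnd : P.roots.Nodup) :
    (schurSzego k P Q).roots.Nodup := by
  rw [Multiset.nodup_iff_count_le_one]
  intro x
  by_contra! h1
  have hR0 := (hP.schurSzego hk hPdeg hQdeg hQ).ne_zero
  rw [count_roots, one_lt_rootMultiplicity_iff_isRoot hR0] at h1
  obtain ⟨σ, hσ', hσ⟩ := hP.exists_sign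
  subst hPdeg
  have := multiplierEval_schurSzego_ofReal_ne_zero hk hQdeg hQ _
    (fun z hz => multiplierEval_natCast_ne_zero hP.real_rooted hP.ne_zero hk hσ' hσ hnd z hz) x
  rw [multiplierEval_natCast _ _ (natDegree_schurSzego_le _ P Q),
    eval_map_ofReal_real, eval_map_ofReal_real, h1.1.eq_zero, h1.2.eq_zero] at this
  simp at this

theorem lmesh_le_lmesh_schurSzego {k : ℕ} (hk : 2 ≤ k) {P Q : ℝ[X]}
    (hPdeg : P.natDegree = k) (hQdeg : Q.natDegree = k)
    (hP : HasRealRootsOfSameSign P) (hQ : HasRealRootsOfSameSign Q) :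
    lmesh P ≤ lmesh (schurSzego k P Q) := by
  have hk0 : k ≠ 0 := by omega
  have hR := hP.schurSzego hk0 hPdeg hQdeg hQ
  have hRdeg := natDegree_schurSzego k P Q hP.ne_zero hQ.ne_zero hPdeg hQdeg
  have hlen := length_rootModuli hR.real_rooted
  -- This is where `2 ≤ k` matters: over an empty index type the infimum would be the default `0`.
  have : Nonempty (Fin ((rootModuli (schurSzego k P Q)).length - 1)) := ⟨⟨0, by omega⟩⟩
  refine le_ciInf fun ⟨i, hi⟩ => ?_
  obtain ⟨σ, hσ', hσ⟩ := hP.exists_sign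
  obtain ⟨ρ, hρ', hρ⟩ := hR.exists_sign
  have hmap := map_rootModuli hρ' hρ
  have hpos := rootModuli_pos (P := schurSzego k P Q) (by
    rintro x hx rfl
    simpa using hρ 0 hx)
  have hmono : (rootModuli (schurSzego k P Q))[i] ≤ (rootModuli (schurSzego k P Q))[i + 1] :=
    List.pairwise_iff_getElem.1 (Multiset.pairwise_sort _ _) i (i + 1) _ _ (Nat.lt_succ_self i)
  have hroot : ∀ u ∈ rootModuli (schurSzego k P Q), (schurSzego k P Q).eval (ρ * u) = 0 := by
    intro u hu
    have : ρ * u ∈ (schurSzego k P Q).roots := by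
      rw [← hmap, Multiset.mem_coe]
      exact List.mem_map_of_mem hu
    exact (mem_roots'.1 this).2
  set u := (rootModuli (schurSzego k P Q))[i] with hu
  set v := (rootModuli (schurSzego k P Q))[i + 1] with hv
  have hu0 : 0 < u := hpos u (List.getElem_mem _)
  change lmesh P ≤ v / u
  by_contra! hlt
  have hPne : ∀ x ∈ P.roots, x ≠ 0 := by
    rintro x hx rfl
    simpa using hσ 0 hx
  -- Ratio `1` is a multiple root, handled by simplicity; otherwise `q = v / u` is itself the
  -- forbidden dilation.
  rcases hmono.eq_or_lt with heq | hne
  · rw [← heq, div_self hu0.ne'] at hlt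
    have hnd : P.roots.Nodup := by
      rw [← map_rootModuli hσ' hσ, Multiset.coe_nodup]
      refine List.Nodup.map ?_ ?_
      · have : σ ≠ 0 := by rcases hσ' with rfl | rfl <;> norm_num
        exact mul_right_injective₀ this
      · exact (pairwise_rootModuli_of_lt_lmesh hPne hlt).imp fun h => by
          rw [one_mul] at h; exact h.ne
    have h1 := nodup_roots_schurSzego hk0 hPdeg hQdeg hP hQ hnd
    rw [← hmap, Multiset.coe_nodup] at h1
    have h2 := (h1.of_map _).getElem_inj_iff (i := i) (j := i + 1) (hi := by omega)
      (hj := by omega)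
    have := h2.1 heq
    omega
  · refine schurSzego_eval_mul_ne_zero hk0 hPdeg hQdeg hP hQ ((one_lt_div hu0).2 hne) hlt
      (hroot u (List.getElem_mem _)) ?_
    have : v / u * (ρ * u) = ρ * v := by field_simp
    rw [this]
    exact hroot v (List.getElem_mem _)

theorem mainTheorem1 (k : ℕ) (hk : 2 ≤ k) (P Q : ℝ[X])
    (hPdeg : P.natDegree = k) (hQdeg : Q.natDegree = k)
    (hP : HasRealRootsOfSameSign P) (hQ : HasRealRootsOfSameSign Q) :
    (schurSzego k P Q).natDegree = k ∧
      HasRealRootsOfSameSign (schurSzego k P Q) ∧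
      max (lmesh P) (lmesh Q) ≤ lmesh (schurSzego k P Q) := by
  refine ⟨natDegree_schurSzego k P Q hP.ne_zero hQ.ne_zero hPdeg hQdeg,
    hP.schurSzego (by omega) hPdeg hQdeg hQ,
    max_le (lmesh_le_lmesh_schurSzego hk hPdeg hQdeg hP hQ) ?_⟩
  rw [schurSzego_comm]
  exact lmesh_le_lmesh_schurSzego hk hQdeg hPdeg hQ hP
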